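/- Let $n,d\ge 1$. Let $\mathcal G$ be a weighted directed graph on the nodes $v_1,\dots,v_n$ with adjacency matrix $\mathcal A=(a_{ij})\in\mathbb R^{n\times n}$, where $a_{ij}\ge 0$, $a_{ii}=0$, and $a_{ij}>0$ if and only if there is an edge from $v_j$ to $v_i$. Its Laplacian is $\mathcal L=(l_{ij})$ with $l_{ii}=\sum_{k\ne i}a_{ik}$ and $l_{ij}=-a_{ij}$ for $j\neq i$. Let $C\in\mathbb R^{d\times d}$. For $b\in\mathbb R^n$ put $B=\operatorname{diag}(b_1,\dots,b_n)$ and consider the system (Model 1 with stubbornness parameters $b_i$) $$\dot x(t)=-F_b\,x(t)+(B\otimes I_d)\,x(0),\qquad F_b=I_{nd}+(\mathcal L-I_n)\otimes C+B\otimes I_d,\qquad t\ge 0,$$ where $x=(x_1^\top,\dots,x_n^\top)^\top\in\mathbb R^{nd}$ and $x_i\in\mathbb R^d$ is the opinion vector of individual $i$; equivalently, $\dot x_i=\sum_j a_{ij}C(x_j-x_i)+(C-I_d)x_i+b_i(x_i(0)-x_i)$. Assume the following. 1. $1$ is a semi-simple eigenvalue of $C$ (it is an eigenvalue whose geometric and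 algebraic multiplicities agree), all other eigenvalues of $C$ have real part $<1$, and $c_{kk}\ge 0$ for all $k$. 2. $\mathcal G$ has a directed spanning tree, and the nodes are ordered such that, for some $1\le r\le n$, the nodes $v_1,\dots,v_r$ induce a closed (no edge enters it from outside) and strongly connected subgraph; that is, $\mathcal L=\begin{bmatrix}\mathcal L_{11}&0\\ \mathcal L_{21}&\mathcal L_{22}\end{bmatrix}$ with $\mathcal L_{11}\in\mathbb R^{r\times r}$ irreducible. 3. With the eigenvalues $\lambda_1(\mathcal L)=0,\lambda_2(\mathcal L),\dots,\lambda_n(\mathcal L)$ of $\mathcal L$ and $\lambda_1(C),\dots,\lambda_d(C)$ of $C$ listed with algebraic multiplicity, $\mathrm{Re}\big((1-\lambda_i(\mathcal L))\lambda_k(C)\big)<1$ for all $i\in\{2,\dots,n\}$ and $k\in\{1,\dots,d\}$. Say that the system with parameters $b$ *converges to its stubborn limit* if $F_b$ is nonsingular and, for every initial value $x(0)$, the solution satisfies $\lim_{t\to\infty}x(t)=F_b^{-1}(B\otimes I_d)\,x(0)$. Then: (i) There is $\delta>0$, depending only on $\mathcal G$ and $C$, such that the system converges to its stubborn limit for every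 $b$ with $0\le b_i<\delta$ for all $i$ and $b_j>0$ for some $j\in\{1,\dots,r\}$. (ii) For every $\alpha>0$ there is $\delta>0$, depending only on $\alpha$, $\mathcal G$ and $C$, such that the system converges to its stubborn limit whenever $b_i=\alpha+\epsilon_i$ with $\epsilon_i\in\mathbb R$, $|\epsilon_i|<\delta$ for all $i$. -/

import Mathlib

namespace OpinionDynamics

open scoped Kronecker

/-- A weighted directed graph on the nodes `Fin n`, given by its weighted adjacency matrix:
nonnegative weights, no self-loops. -/
structure WeightedDigraph (n : ℕ) where
  adj : Matrix (Fin n) (Fin n) ℝ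
  adj_nonneg : ∀ i j, 0 ≤ adj i j
  adj_diag : ∀ i, adj i i = 0

namespace WeightedDigraph

variable {n : ℕ}

/-- `G.Edge j i`: there is an edge from `j` to `i` (individual `i` learns of the opinion of `j`),
which is the case exactly when the weight `a i j` is positive. -/
def Edge (G : WeightedDigraph n) (j i : Fin n) : Prop := 0 < G.adj i j

/-- The Laplacian: `l i i = ∑ k ≠ i, a i k` and `l i j = - a i j` for `j ≠ i`. -/
def laplacian (G : WeightedDigraph n) : Matrix (Fin n) (Fin n) ℝ :=
  Matrix.of fun i j => if i = j then ∑ k ∈ Finset.univ.erase i, G.adj i k else - G.adj i j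

/-- A subset `T` of the edges of `G` forms a directed tree with root `root` that connects all the
nodes: the root has no parent, every other node has exactly one parent, and there is a directed
path in `T` from the root to every node. -/
def IsDirectedSpanningTree (G : WeightedDigraph n) (T : Fin n → Fin n → Prop)
    (root : Fin n) : Prop :=
  (∀ u v, T u v → G.Edge u v) ∧
  (∀ u, ¬ T u root) ∧
  (∀ v, v ≠ root → ∃! u, T u v) ∧
  (∀ v, Relation.ReflTransGen T root v)

def HasDirectedSpanningTree (G : WeightedDigraph n) : Prop :=
  ∃ T root, G.IsDirectedSpanningTree T root

/-- The nodes are ordered so that the first `r` of them (`1 ≤ r ≤ n`) induce a closed and strongly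
connected subgraph: the Laplacian is block lower triangular (no edge enters the subgraph from
outside), and any two of the first `r` nodes are joined by a directed path in the subgraph, i.e.
the leading block is irreducible. -/
structure IsRootOrdered (G : WeightedDigraph n) (r : ℕ) : Prop where
  pos : 1 ≤ r
  le : r ≤ n
  upper_right_zero : ∀ i j : Fin n, i.val < r → r ≤ j.val → G.laplacian i j = 0
  strongly_connected : ∀ i j : Fin n, i.val < r → j.val < r →
    Relation.ReflTransGen (fun u v : Fin n => u.val < r ∧ v.val < r ∧ G.Edge u v) i j

end WeightedDigraph

/-- The eigenvalues of a real square matrix: the complex roots of its characteristic polynomial,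
counted with algebraic multiplicity. -/
noncomputable def eigenvalues {m : ℕ} (M : Matrix (Fin m) (Fin m) ℝ) : Multiset ℂ :=
  (M.map Complex.ofReal).charpoly.roots

/-- The assumption on the logic matrix: `1` is a semi-simple eigenvalue (of multiplicity at least
one, with equal geometric and algebraic multiplicities), all the other eigenvalues have real part
less than `1`, and the diagonal is nonnegative. -/
structure IsLogicMatrix {d : ℕ} (C : Matrix (Fin d) (Fin d) ℝ) : Prop where
  one_mem : (1 : ℂ) ∈ eigenvalues C
  semisimple : Module.finrank ℂ
      (Module.End.eigenspace (Matrix.toLin' (C.map Complex.ofReal)) 1) = (eigenvalues C).count 1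
  re_lt_one : ∀ z ∈ eigenvalues C, z ≠ 1 → z.re < 1
  diag_nonneg : ∀ k, 0 ≤ C k k

/-- The consensus condition `Re ((1 - λᵢ(L)) λₖ(C)) < 1` for all `i ≠ 1` and all `k`, where
`λ₁(L) = 0`: one copy of the eigenvalue `0` of `L` is left out. -/
def ConsensusCondition {n d : ℕ} (L : Matrix (Fin n) (Fin n) ℝ)
    (C : Matrix (Fin d) (Fin d) ℝ) : Prop :=
  ∀ μ ∈ (eigenvalues L).erase 0, ∀ z ∈ eigenvalues C, ((1 - μ) * z).re < 1

/-- `B ⊗ I_d` with `B = diag b`. -/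
def stubbornnessMatrix {n : ℕ} (d : ℕ) (b : Fin n → ℝ) :
    Matrix (Fin n × Fin d) (Fin n × Fin d) ℝ :=
  Matrix.diagonal b ⊗ₖ (1 : Matrix (Fin d) (Fin d) ℝ)

/-- `I_{nd} + (L - I_n) ⊗ C + B ⊗ I_d`. -/
def systemMatrix {n d : ℕ} (G : WeightedDigraph n) (C : Matrix (Fin d) (Fin d) ℝ)
    (b : Fin n → ℝ) : Matrix (Fin n × Fin d) (Fin n × Fin d) ℝ :=
  1 + (G.laplacian - 1) ⊗ₖ C + stubbornnessMatrix d b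

/-- `x` solves, on `[0, ∞)`, the opinion dynamics of Model 1 with stubbornness `b`; the coordinate
`x t (i, k)` is the opinion of individual `i` on topic `k` at time `t`. -/
def IsModelOneSolution {n d : ℕ} (G : WeightedDigraph n) (C : Matrix (Fin d) (Fin d) ℝ)
    (b : Fin n → ℝ) (x : ℝ → Fin n × Fin d → ℝ) : Prop :=
  ∀ t : ℝ, 0 ≤ t → HasDerivWithinAt x
    (-(systemMatrix G C b).mulVec (x t) + (stubbornnessMatrix d b).mulVec (x 0)) (Set.Ici 0) t

/-- The system matrix is nonsingular and, for all initial opinions `x 0`, the opinions converge to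
`[I_{nd} + (L - I_n) ⊗ C + B ⊗ I_d]⁻¹ (B ⊗ I_d) x 0`. -/
def ConvergesToStubbornLimit {n d : ℕ} (G : WeightedDigraph n) (C : Matrix (Fin d) (Fin d) ℝ)
    (b : Fin n → ℝ) : Prop :=
  IsUnit (systemMatrix G C b) ∧
  ∀ x : ℝ → Fin n × Fin d → ℝ, IsModelOneSolution G C b x →
    Filter.Tendsto x Filter.atTop
      (nhds ((systemMatrix G C b)⁻¹.mulVec ((stubbornnessMatrix d b).mulVec (x 0))))

end OpinionDynamics

namespace OpinionDynamics

open Filter Set Topology Matrix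
open scoped Kronecker

/-! Subtracting the equilibrium turns the system into `y' = -F_b y`, so it suffices that every
eigenvalue of `F_b` has positive real part (`IsPositiveStable`). At `b = 0` the operators `L ⊗ I`
and `I ⊗ C` commute, so each eigenvalue of `F_0` has the form `1 - (1 - μ) z` with `μ`, `z`
eigenvalues of `L`, `C`; the hypotheses leave `0` as the only one with real part at most zero.

Both claims follow by contradiction and compactness: bad parameters tending to their limit give unit
eigenvectors `v_m` with `Re μ_m ≤ 0`, and a subsequence converges to an eigenpair of the limit
operator. In (ii) that operator is `F_0 + α`, whose spectrum lies in `Re > 0`.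

In (i) the limit lies in `ker F_0`, which consists of the consensus vectors `1 ⊗ u` with `C u = u`.
Take `p ≥ 0` with `p L = 0`, positive on the first `r` nodes, and `f` with `f C = f`, `f · u = 1`.
Since `p ⊗ f` annihilates the range of `F_0`, pairing it with the eigenvalue equation gives `μ_m D_m
= ∑ p_i b_i z_i`, where `z_i → 1` and `D_m = ∑ p_i z_i → ∑ p_i > 0`. Multiplied by `conj D_m`, the
left side has real part at most zero and the right side positive real part. -/

lemma tendsto_zero_of_hasDerivWithinAt_neg_mul_add {u h : ℝ → ℂ} {μ : ℂ} (hμ : 0 < μ.re)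
    (hu : ∀ t, 0 ≤ t → HasDerivWithinAt u (-μ * u t + h t) (Ici 0) t)
    (hh : Tendsto h atTop (𝓝 0)) : Tendsto u atTop (𝓝 0) := by
  rw [Metric.tendsto_atTop]
  intro ε hε
  -- With this threshold the forcing, after multiplication by `exp (μ (t - T))`, is dominated by the
  -- derivative of the barrier in `hB`.
  obtain ⟨T₀, hT₀⟩ := Metric.tendsto_atTop.1 hh (μ.re * (ε / 2)) (by positivity)
  set T := max T₀ 0 with hT
  have hT0 : 0 ≤ T := le_max_right _ _
  have key : ∀ t, T ≤ t →
      ‖u t‖ ≤ ‖u T‖ * Real.exp (-(μ.re * (t - T))) + ε / 2 := by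
    intro t ht
    have hexp : ∀ s : ℝ, HasDerivAt (fun s : ℝ => Complex.exp (μ * ((s : ℂ) - T)))
        (Complex.exp (μ * ((s : ℂ) - T)) * μ) s := by
      intro s
      have h1 : HasDerivAt (fun s : ℝ => μ * ((s : ℂ) - T)) μ s := by
        simpa using (((hasDerivAt_id (s : ℂ)).sub_const (T : ℂ)).const_mul μ).comp_ofReal
      exact h1.cexp
    have hnorm : ∀ s : ℝ, ‖Complex.exp (μ * ((s : ℂ) - T))‖ = Real.exp (μ.re * (s - T)) := by
      intro s
      rw [Complex.norm_exp]
      congr 1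
      simp [Complex.mul_re]
    have hv : ∀ s : ℝ, 0 ≤ s → HasDerivWithinAt (fun s : ℝ => Complex.exp (μ * ((s : ℂ) - T)) * u s)
        (Complex.exp (μ * ((s : ℂ) - T)) * h s) (Ici 0) s := by
      intro s hs
      refine ((hexp s).hasDerivWithinAt.mul (hu s hs)).congr_deriv ?_
      ring
    have hB : ∀ s, HasDerivAt (fun s : ℝ => ‖u T‖ + ε / 2 * Real.exp (μ.re * (s - T)))
        (ε / 2 * (Real.exp (μ.re * (s - T)) * μ.re)) s := by
      intro s
      have h1 : HasDerivAt (fun s : ℝ => μ.re * (s - T)) μ.re s := by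
        simpa using ((hasDerivAt_id s).sub_const T).const_mul μ.re
      exact (h1.exp.const_mul (ε / 2)).const_add _
    have := image_norm_le_of_norm_deriv_right_le_deriv_boundary (a := T) (b := t)
      (fun s hs => ((hv s (hT0.trans hs.1)).continuousWithinAt).mono
        (fun r hr => hT0.trans hr.1))
      (fun s hs => (hv s (hT0.trans hs.1)).mono (fun r hr => (hT0.trans hs.1).trans hr))
      (by simp; positivity) hB
      (fun s hs => by
        have h1 := hT₀ s ((le_max_left _ _).trans hs.1)
        rw [dist_zero_right] at h1
        rw [norm_mul, hnorm]
        nlinarith [Real.exp_pos (μ.re * (s - T))]) (right_mem_Icc.2 ht)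
    rw [norm_mul, hnorm] at this
    have he : Real.exp (μ.re * (t - T)) * Real.exp (-(μ.re * (t - T))) = 1 := by
      rw [← Real.exp_add]; simp
    have h2 := mul_le_mul_of_nonneg_right this (Real.exp_pos (-(μ.re * (t - T)))).le
    calc ‖u t‖ = Real.exp (μ.re * (t - T)) * ‖u t‖ * Real.exp (-(μ.re * (t - T))) := by
          rw [mul_right_comm, he, one_mul]
      _ ≤ _ := h2
      _ = ‖u T‖ * Real.exp (-(μ.re * (t - T))) +
          ε / 2 * (Real.exp (μ.re * (t - T)) * Real.exp (-(μ.re * (t - T)))) := by ring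
      _ = _ := by rw [he, mul_one]
  have hlim : Tendsto (fun t => ‖u T‖ * Real.exp (-(μ.re * (t - T))) + ε / 2) atTop
      (𝓝 (‖u T‖ * 0 + ε / 2)) := by
    refine ((Real.tendsto_exp_neg_atTop_nhds_zero.comp ?_).const_mul _).add_const _
    exact (tendsto_atTop_add_const_right _ (-T) tendsto_id).const_mul_atTop hμ
  have hev := hlim.eventually (gt_mem_nhds (show ‖u T‖ * 0 + ε / 2 < ε by simp [hε]))
  obtain ⟨N, hN⟩ := (hev.and (eventually_ge_atTop T)).exists_forall_of_atTop
  refine ⟨N, fun t ht => ?_⟩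
  rw [dist_zero_right]
  exact (key t (hN t ht).2).trans_lt (hN t ht).1

/-- All complex eigenvalues of the real matrix `F` have positive real part. -/
def IsPositiveStable {ι : Type*} [Fintype ι] (F : Matrix ι ι ℝ) : Prop :=
  ∀ (μ : ℂ) (v : ι → ℂ), v ≠ 0 → F.map Complex.ofReal *ᵥ v = μ • v → 0 < μ.re

/-! ### Positive stability: invertibility and decay of solutions. -/

section Stability

variable {ι : Type*} [Fintype ι] [DecidableEq ι]

lemma IsPositiveStable.transpose {F : Matrix ι ι ℝ} (hF : IsPositiveStable F) :
    IsPositiveStable Fᵀ := by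
  intro μ v hv h
  have h1 : v ᵥ* (F.map Complex.ofReal - μ • 1) = 0 := by
    rw [← Matrix.mulVec_transpose, transpose_sub, transpose_smul, transpose_one, sub_mulVec,
      ← transpose_map, h, smul_mulVec, one_mulVec, sub_self]
  obtain ⟨w, hw, h2⟩ := exists_mulVec_eq_zero_iff.2 (exists_vecMul_eq_zero_iff.1 ⟨v, hv, h1⟩)
  rw [sub_mulVec, smul_mulVec, one_mulVec, sub_eq_zero] at h2
  exact hF μ w hw h2

lemma IsPositiveStable.isUnit {F : Matrix ι ι ℝ} (hF : IsPositiveStable F) : IsUnit F := by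
  rw [isUnit_iff_isUnit_det, isUnit_iff_ne_zero]
  intro h
  obtain ⟨v, hv, h0⟩ := exists_mulVec_eq_zero_iff.2 h
  refine lt_irrefl (0 : ℝ) (hF 0 (fun i => (v i : ℂ)) ?_ ?_)
  · intro h1
    exact hv (funext fun i => by simpa using congrFun h1 i)
  · funext i
    have := congrFun h0 i
    simp only [mulVec, dotProduct, Pi.zero_apply] at this
    simp only [mulVec, dotProduct, map_apply, zero_smul, Pi.zero_apply]
    exact_mod_cast this

/-- If `φ` is a generalized eigenvector of `Fᵀ`, then `φ ⬝ᵥ y` solves a scalar linear equation whose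
forcing `(A - μ) φ ⬝ᵥ y` has lower order and decays by induction. Such `φ` span the whole space. -/
lemma IsPositiveStable.tendsto_zero {F : Matrix ι ι ℝ} (hF : IsPositiveStable F)
    {y : ℝ → ι → ℝ} (hy : ∀ t, 0 ≤ t → HasDerivWithinAt y (-(F *ᵥ y t)) (Ici 0) t) :
    Tendsto y atTop (𝓝 0) := by
  set A : Module.End ℂ (ι → ℂ) := toLin' (Fᵀ.map Complex.ofReal) with hA
  set Y : ℝ → ι → ℂ := fun t i => (y t i : ℂ) with hY
  have hderiv : ∀ φ : ι → ℂ, ∀ t, 0 ≤ t →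
      HasDerivWithinAt (fun t => φ ⬝ᵥ Y t) (-(A φ ⬝ᵥ Y t)) (Ici 0) t := by
    intro φ t ht
    have h1 : ∀ i, HasDerivWithinAt (fun t => φ i * Y t i) (φ i * ((-(F *ᵥ y t) i : ℝ) : ℂ))
        (Ici 0) t := fun i =>
      ((hasDerivWithinAt_pi.1 (hy t ht) i).ofReal_comp).const_mul (φ i)
    refine (HasDerivWithinAt.fun_sum (u := Finset.univ) (fun i _ => h1 i)).congr_deriv ?_
    rw [hA, toLin'_apply, transpose_map, mulVec_transpose, ← dotProduct_mulVec]
    simp [dotProduct, mulVec, hY]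
  have hgen : ∀ μ : ℂ, ∀ k : ℕ, ∀ φ : ι → ℂ, ((A - μ • 1) ^ k) φ = 0 →
      Tendsto (fun t => φ ⬝ᵥ Y t) atTop (𝓝 0) := by
    intro μ k
    induction k with
    | zero =>
      intro φ h
      simp only [pow_zero, Module.End.one_apply] at h
      simp [h]
    | succ k ih =>
      intro φ h
      rw [pow_succ, Module.End.mul_apply] at h
      have h1 := ih _ h
      by_cases hφ : (A - μ • 1) φ = 0 ∧ φ = 0
      · simp [hφ.2]
      by_cases hμ : 0 < μ.re
      · refine tendsto_zero_of_hasDerivWithinAt_neg_mul_add hμ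
          (h := fun t => -((A - μ • 1) φ ⬝ᵥ Y t)) (fun t ht => ?_) (by simpa using h1.neg)
        convert hderiv φ t ht using 1
        simp [sub_dotProduct, smul_dotProduct]
        ring
      -- Here `μ` is not an eigenvalue, so `A - μ` is injective and `φ = 0`.
      · have hinj : ∀ ψ, (A - μ • 1) ψ = 0 → ψ = 0 := by
          intro ψ hψ
          by_contra hne
          refine hμ (hF.transpose μ ψ hne ?_)
          simpa [hA, sub_eq_zero] using hψ
        have hinjk : ∀ j : ℕ, ∀ ψ, ((A - μ • 1) ^ j) ψ = 0 → ψ = 0 := by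
          intro j
          induction j with
          | zero => intro ψ hψ; simpa using hψ
          | succ j ihj =>
            intro ψ hψ
            rw [pow_succ, Module.End.mul_apply] at hψ
            exact hinj _ (ihj _ hψ)
        simp [hinj _ (hinjk _ _ h)]
  have hall : ∀ φ : ι → ℂ, Tendsto (fun t => φ ⬝ᵥ Y t) atTop (𝓝 0) := by
    intro φ
    have hφ : φ ∈ ⨆ μ, A.maxGenEigenspace μ := by
      rw [Module.End.iSup_maxGenEigenspace_eq_top]; trivial
    induction hφ using Submodule.iSup_induction' with
    | mem μ φ h =>
      obtain ⟨k, hk⟩ := (Module.End.mem_maxGenEigenspace _ _ _).1 h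
      exact hgen μ k φ hk
    | zero => simp
    | add φ ψ _ _ h1 h2 => simpa [add_dotProduct] using h1.add h2
  rw [tendsto_pi_nhds]
  intro i
  have h1 := (Complex.continuous_re.tendsto 0).comp (hall (Pi.single i 1))
  simpa [hY, Function.comp_def] using h1

end Stability

lemma convergesToStubbornLimit_of_isPositiveStable {n d : ℕ} {G : WeightedDigraph n}
    {C : Matrix (Fin d) (Fin d) ℝ} {b : Fin n → ℝ}
    (hF : IsPositiveStable (systemMatrix G C b)) : ConvergesToStubbornLimit G C b := by
  refine ⟨hF.isUnit, fun x hx => ?_⟩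
  set F := systemMatrix G C b with hFdef
  set p := F⁻¹ *ᵥ (stubbornnessMatrix d b *ᵥ x 0) with hp
  have hFp : F *ᵥ p = stubbornnessMatrix d b *ᵥ x 0 := by
    rw [hp, mulVec_mulVec, mul_nonsing_inv _ ((isUnit_iff_isUnit_det _).1 hF.isUnit), one_mulVec]
  have hy : Tendsto (fun t => x t - p) atTop (𝓝 0) := by
    refine hF.tendsto_zero fun t ht => ?_
    refine ((hx t ht).sub_const p).congr_deriv ?_
    rw [mulVec_sub, hFp, ← hFdef]
    abel
  simpa using hy.add_const p

/-! ### Left and right null vectors of the Laplacian. -/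

namespace WeightedDigraph

variable {n : ℕ} (G : WeightedDigraph n)

lemma laplacian_eq : G.laplacian = diagonal (fun i => ∑ k, G.adj i k) - G.adj := by
  ext i j
  by_cases h : i = j
  · subst h
    simp [laplacian, G.adj_diag]
  · simp [laplacian, h]

lemma laplacian_mulVec_apply (x : Fin n → ℝ) (i : Fin n) :
    (G.laplacian *ᵥ x) i = ∑ j, G.adj i j * (x i - x j) := by
  rw [laplacian_eq, sub_mulVec, Pi.sub_apply, mulVec_diagonal]
  simp [mulVec, dotProduct, mul_sub, Finset.sum_mul, Finset.sum_sub_distrib]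

lemma vecMul_laplacian_apply (w : Fin n → ℝ) (j : Fin n) :
    (w ᵥ* G.laplacian) j = w j * ∑ k, G.adj j k - ∑ i, w i * G.adj i j := by
  rw [laplacian_eq, vecMul_sub, Pi.sub_apply, vecMul_diagonal]
  simp [vecMul, dotProduct]

variable {G}

lemma HasDirectedSpanningTree.exists_root (hG : G.HasDirectedSpanningTree) :
    ∃ root, ∀ v, Relation.ReflTransGen G.Edge root v := by
  obtain ⟨T, root, hT, -, -, h⟩ := hG
  exact ⟨root, fun v => Relation.ReflTransGen.mono hT _ _ (h v)⟩

/-- Maximum principle: at a maximum the sum `(L x)_i` has nonnegative terms, so its vanishing passes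
the maximal value to every in-neighbour. -/
lemma eq_of_laplacian_mulVec_eq_zero_of_reflTransGen {x : Fin n → ℝ}
    (hx : G.laplacian *ᵥ x = 0) {j m : Fin n} (hm : ∀ i, x i ≤ x m)
    (h : Relation.ReflTransGen G.Edge j m) : x j = x m := by
  induction h using Relation.ReflTransGen.head_induction_on with
  | refl => rfl
  | @head a c hac _ ih =>
    have h0 := congrFun hx c
    rw [laplacian_mulVec_apply, Pi.zero_apply, Finset.sum_eq_zero_iff_of_nonneg] at h0
    · have := h0 a (Finset.mem_univ a)
      have hpos : 0 < G.adj c a := hac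
      rw [mul_eq_zero, or_iff_right hpos.ne', sub_eq_zero] at this
      rw [← this, ih]
    · intro i _
      exact mul_nonneg (G.adj_nonneg _ _) (by rw [ih]; linarith [hm i])

lemma eq_of_laplacian_mulVec_eq_zero (hG : G.HasDirectedSpanningTree) {x : Fin n → ℝ}
    (hx : G.laplacian *ᵥ x = 0) (i j : Fin n) : x i = x j := by
  obtain ⟨root, hroot⟩ := hG.exists_root
  have : Nonempty (Fin n) := ⟨root⟩
  obtain ⟨m, hm⟩ := Finite.exists_max x
  obtain ⟨m', hm'⟩ := Finite.exists_min x
  have h1 := eq_of_laplacian_mulVec_eq_zero_of_reflTransGen hx hm (hroot m)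
  have h2 := eq_of_laplacian_mulVec_eq_zero_of_reflTransGen (x := -x) (m := m')
    (by rw [mulVec_neg, hx, neg_zero]) (fun i => by simpa using hm' i) (hroot m')
  simp only [Pi.neg_apply, neg_inj] at h2
  have := hm i; have := hm j; have := hm' i; have := hm' j
  linarith

lemma eq_of_complex_laplacian_mulVec_eq_zero (hG : G.HasDirectedSpanningTree) {x : Fin n → ℂ}
    (hx : G.laplacian.map Complex.ofReal *ᵥ x = 0) (i j : Fin n) : x i = x j := by
  have key : ∀ k, (∑ j, (G.laplacian k j : ℂ) * x j) = 0 := fun k => by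
    simpa [mulVec, dotProduct] using congrFun hx k
  apply Complex.ext
  · refine eq_of_laplacian_mulVec_eq_zero hG (x := fun k => (x k).re) (funext fun k => ?_) i j
    simpa [mulVec, dotProduct] using congrArg Complex.re (key k)
  · refine eq_of_laplacian_mulVec_eq_zero hG (x := fun k => (x k).im) (funext fun k => ?_) i j
    simpa [mulVec, dotProduct] using congrArg Complex.im (key k)

/-- The triangle inequality makes each coordinate nonpositive, while the coordinates sum to zero
because the rows of `L` do. -/
lemma vecMul_laplacian_abs {w : Fin n → ℝ} (hw : w ᵥ* G.laplacian = 0) :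
    |w| ᵥ* G.laplacian = 0 := by
  have h1 : ∀ j, (|w| ᵥ* G.laplacian) j ≤ 0 := by
    intro j
    have h := congrFun hw j
    rw [vecMul_laplacian_apply, Pi.zero_apply, sub_eq_zero] at h
    rw [vecMul_laplacian_apply, sub_nonpos]
    calc |w| j * ∑ k, G.adj j k = |w j * ∑ k, G.adj j k| := by
          rw [abs_mul, abs_of_nonneg (Finset.sum_nonneg fun k _ => G.adj_nonneg j k), Pi.abs_apply]
      _ ≤ ∑ i, |w i * G.adj i j| := by rw [h]; exact Finset.abs_sum_le_sum_abs _ _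
      _ = _ := by simp [abs_mul, abs_of_nonneg (G.adj_nonneg _ _)]
  have h2 : ∑ j, (|w| ᵥ* G.laplacian) j = 0 := by
    simp only [vecMul_laplacian_apply, Finset.sum_sub_distrib, Finset.mul_sum]
    rw [Finset.sum_comm, sub_self]
  funext j
  exact (Finset.sum_eq_zero_iff_of_nonpos fun j _ => h1 j).1 h2 j (Finset.mem_univ j)

/-- Where `p` vanishes, the balance equation reads `∑ p_i a_ij = 0` with nonnegative terms, so zeros
spread along outgoing edges. -/
lemma eq_zero_of_vecMul_laplacian_of_reflTransGen {p : Fin n → ℝ} (hp : 0 ≤ p)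
    (hpL : p ᵥ* G.laplacian = 0) {j i : Fin n} (hj : p j = 0)
    (h : Relation.ReflTransGen G.Edge j i) : p i = 0 := by
  induction h with
  | refl => exact hj
  | @tail c i _ hci ih =>
    have h0 := congrFun hpL c
    rw [vecMul_laplacian_apply, ih, zero_mul, zero_sub, Pi.zero_apply, neg_eq_zero,
      Finset.sum_eq_zero_iff_of_nonneg
        fun k _ => mul_nonneg (hp k) (G.adj_nonneg _ _)] at h0
    have hpos : 0 < G.adj i c := hci
    have := h0 i (Finset.mem_univ i)
    rwa [mul_eq_zero, or_iff_left hpos.ne'] at this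

lemma IsRootOrdered.lt_of_reflTransGen {r : ℕ} (hr : G.IsRootOrdered r) {u v : Fin n}
    (hv : v.val < r) (h : Relation.ReflTransGen G.Edge u v) : u.val < r := by
  induction h using Relation.ReflTransGen.head_induction_on with
  | refl => exact hv
  | @head a c hac _ ih =>
    by_contra ha
    have h0 := hr.upper_right_zero c a ih (not_lt.1 ha)
    have hca : c ≠ a := fun h => ha (h ▸ ih)
    have hpos : 0 < G.adj c a := hac
    simp only [laplacian, of_apply, if_neg hca, neg_eq_zero] at h0
    exact hpos.ne' h0

/-- A zero of `|w|` among the first `r` nodes would spread to the root of the tree, which closedness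
puts among these nodes, and from there to all nodes. -/
lemma IsRootOrdered.exists_left_null {r : ℕ} (hG : G.HasDirectedSpanningTree)
    (hr : G.IsRootOrdered r) :
    ∃ p : Fin n → ℝ, 0 ≤ p ∧ p ᵥ* G.laplacian = 0 ∧ ∀ j : Fin n, j.val < r → 0 < p j := by
  obtain ⟨root, hroot⟩ := hG.exists_root
  have h1 : G.laplacian *ᵥ (fun _ => (1 : ℝ)) = 0 := by
    funext i
    simp [laplacian_mulVec_apply]
  obtain ⟨w, hw, hwL⟩ := exists_vecMul_eq_zero_iff.2
    (exists_mulVec_eq_zero_iff.1 ⟨_, fun h => one_ne_zero (congrFun h root), h1⟩)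
  refine ⟨|w|, abs_nonneg w, vecMul_laplacian_abs hwL, fun j hj => ?_⟩
  refine lt_of_le_of_ne (abs_nonneg w j) fun h0 => hw ?_
  have hroot_lt := hr.lt_of_reflTransGen hj (hroot j)
  have hj_root : Relation.ReflTransGen G.Edge j root :=
    Relation.ReflTransGen.mono (fun _ _ h => h.2.2) _ _ (hr.strongly_connected j root hj hroot_lt)
  funext i
  have := eq_zero_of_vecMul_laplacian_of_reflTransGen (abs_nonneg w) (vecMul_laplacian_abs hwL)
    h0.symm (hj_root.trans (hroot i))
  simpa using this

end WeightedDigraph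

/-! ### Eigenvectors in invariant subspaces. -/

lemma mem_eigenvalues_of_mulVec {m : ℕ} {M : Matrix (Fin m) (Fin m) ℝ} {μ : ℂ} {v : Fin m → ℂ}
    (hv : v ≠ 0) (h : M.map Complex.ofReal *ᵥ v = μ • v) : μ ∈ eigenvalues M := by
  rw [eigenvalues, Polynomial.mem_roots (charpoly_monic _).ne_zero, Polynomial.IsRoot.def,
    eval_charpoly]
  refine exists_mulVec_eq_zero_iff.1 ⟨v, hv, ?_⟩
  rw [sub_mulVec, h, sub_eq_zero]
  simp [scalar_apply, ← smul_one_eq_diagonal, smul_mulVec]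

lemma exists_common_eigenvector {V : Type*} [AddCommGroup V] [Module ℂ V] [FiniteDimensional ℂ V]
    {f g : Module.End ℂ V} (hfg : Commute f g) {W : Submodule ℂ V} (hW : W ≠ ⊥)
    (hf : ∀ v ∈ W, f v ∈ W) (hg : ∀ v ∈ W, g v ∈ W) :
    ∃ v ∈ W, v ≠ 0 ∧ ∃ μ z : ℂ, f v = μ • v ∧ g v = z • v := by
  have hWn : Nontrivial W := Submodule.nontrivial_iff_ne_bot.2 hW
  obtain ⟨z, hz⟩ := Module.End.exists_eigenvalue (g.restrict hg)
  set U := W ⊓ Module.End.eigenspace g z with hU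
  obtain ⟨w, hw, hw0⟩ := hz.exists_hasEigenvector
  have hwU : (w : V) ∈ U := by
    refine ⟨w.2, Module.End.mem_eigenspace_iff.2 ?_⟩
    simpa using congrArg Subtype.val (Module.End.mem_eigenspace_iff.1 hw)
  have hfU : ∀ v ∈ U, f v ∈ U := by
    rintro v ⟨hv1, hv2⟩
    refine ⟨hf v hv1, Module.End.mem_eigenspace_iff.2 ?_⟩
    rw [← Module.End.mul_apply, ← hfg.eq, Module.End.mul_apply, Module.End.mem_eigenspace_iff.1 hv2,
      map_smul]
  have hUn : Nontrivial U := ⟨⟨w, hwU⟩, 0, fun h => hw0 (by simpa using congrArg Subtype.val h)⟩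
  obtain ⟨μ, hμ⟩ := Module.End.exists_eigenvalue (f.restrict hfU)
  obtain ⟨v, hv, hv0⟩ := hμ.exists_hasEigenvector
  refine ⟨v, v.2.1, by simpa using hv0, μ, z, ?_, Module.End.mem_eigenspace_iff.1 v.2.2⟩
  simpa using congrArg Subtype.val (Module.End.mem_eigenspace_iff.1 hv)

/-- `W` is the sum of the generalized eigenspaces of `g` restricted to it, and a nonzero one
contains a true eigenvector. -/
lemma mem_maxGenEigenspace_of_forall_eigenvalue_eq {V : Type*} [AddCommGroup V] [Module ℂ V] [FiniteDimensional ℂ V]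
    {g : Module.End ℂ V} {W : Submodule ℂ V} (hg : ∀ v ∈ W, g v ∈ W) {z₀ : ℂ}
    (h : ∀ v ∈ W, v ≠ 0 → ∀ z : ℂ, g v = z • v → z = z₀) {v : V} (hv : v ∈ W) :
    v ∈ g.maxGenEigenspace z₀ := by
  have htop := Module.End.iSup_maxGenEigenspace_eq_top (g.restrict hg)
  have hbot : ∀ z, z ≠ z₀ → Module.End.maxGenEigenspace (g.restrict hg) z = ⊥ := by
    intro z hz
    by_contra hne
    have he : Module.End.HasEigenvalue (g.restrict hg) z :=
      Module.End.hasUnifEigenvalue_iff_hasUnifEigenvalue_one (k := ⊤) (by simp) |>.1 hne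
    obtain ⟨w, hw, hw0⟩ := he.exists_hasEigenvector
    refine hz (h w w.2 (by simpa using hw0) z ?_)
    simpa using congrArg Subtype.val (Module.End.mem_eigenspace_iff.1 hw)
  have hle : ⨆ z, Module.End.maxGenEigenspace (g.restrict hg) z ≤ Module.End.maxGenEigenspace (g.restrict hg) z₀ := by
    refine iSup_le fun z => ?_
    by_cases hz : z = z₀
    · rw [hz]
    · simp [hbot z hz]
  have hmem : (⟨v, hv⟩ : W) ∈ Module.End.maxGenEigenspace (g.restrict hg) z₀ :=
    hle (htop ▸ Submodule.mem_top)
  rw [Module.End.maxGenEigenspace, Module.End.genEigenspace_restrict] at hmem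
  simpa using hmem

/-! ### Consequences of the semi-simplicity of the eigenvalue `1` of `C`. -/

section Logic

variable {d : ℕ} {C : Matrix (Fin d) (Fin d) ℝ}

lemma IsLogicMatrix.maxGenEigenspace_one (hC : IsLogicMatrix C) :
    Module.End.maxGenEigenspace (toLin' (C.map Complex.ofReal)) 1 =
      Module.End.eigenspace (toLin' (C.map Complex.ofReal)) 1 := by
  refine (Submodule.eq_of_le_of_finrank_eq
    (Module.End.genEigenspace_le_maximal (toLin' (C.map Complex.ofReal)) 1 1) ?_).symm
  rw [LinearMap.finrank_maxGenEigenspace_eq, charpoly_toLin', ← Polynomial.count_roots]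
  exact hC.semisimple

lemma IsLogicMatrix.mulVec_eq_of_pow (hC : IsLogicMatrix C) {u : Fin d → ℂ} {k : ℕ}
    (h : ((toLin' (C.map Complex.ofReal) - (1 : ℂ) • 1) ^ k) u = 0) :
    C.map Complex.ofReal *ᵥ u = u := by
  have h1 := (Module.End.mem_maxGenEigenspace _ _ _).2 ⟨k, h⟩
  rw [hC.maxGenEigenspace_one, Module.End.mem_eigenspace_iff] at h1
  simpa using h1

/-- If `u = (C - 1) y`, then `(C - 1)² y = 0`, and semi-simplicity forces `u = 0`. Hence some
functional kills the range of `C - 1` but not `u`. -/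
lemma IsLogicMatrix.exists_left_eigenvector (hC : IsLogicMatrix C) {u : Fin d → ℂ} (hu : u ≠ 0)
    (h : C.map Complex.ofReal *ᵥ u = u) :
    ∃ f : Fin d → ℂ, f ᵥ* C.map Complex.ofReal = f ∧ f ⬝ᵥ u = 1 := by
  set A := toLin' (C.map Complex.ofReal) - (1 : ℂ) • 1 with hA
  have hAu : A u = 0 := by simp [hA, h]
  have hnot : u ∉ LinearMap.range A := by
    rintro ⟨y, hy⟩
    have h1 : (A ^ 2) y = 0 := by rw [pow_two, Module.End.mul_apply, hy, hAu]
    have h2 := hC.mulVec_eq_of_pow h1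
    apply hu
    rw [← hy]
    simp [hA, h2]
  obtain ⟨φ, hφu, hφ⟩ := Submodule.exists_le_ker_of_notMem hnot
  set f : Fin d → ℂ := fun i => (φ u)⁻¹ * φ (Pi.single i 1) with hf
  have hfφ : ∀ v, f ⬝ᵥ v = (φ u)⁻¹ * φ v := by
    intro v
    rw [φ.pi_apply_eq_sum_univ v, dotProduct, Finset.mul_sum]
    refine Finset.sum_congr rfl fun i _ => ?_
    have : (fun j => if i = j then (1 : ℂ) else 0) = Pi.single i 1 := by
      ext j; simp [Pi.single_apply, eq_comm]
    rw [this, hf, smul_eq_mul]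
    ring
  refine ⟨f, ?_, by rw [hfφ, inv_mul_cancel₀ hφu]⟩
  have hall : ∀ v, (f ᵥ* C.map Complex.ofReal) ⬝ᵥ v = f ⬝ᵥ v := by
    intro v
    rw [← dotProduct_mulVec, hfφ, hfφ]
    have := hφ (LinearMap.mem_range_self A v)
    rw [LinearMap.mem_ker, hA] at this
    simp only [one_smul, LinearMap.sub_apply, toLin'_apply, Module.End.one_apply, map_sub,
      sub_eq_zero] at this
    rw [this]
  funext i
  simpa using hall (Pi.single i 1)

end Logic

/-! ### Spectrum and kernel of the system operator without stubbornness. -/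

section Spectral

variable {n d : ℕ}

/-- The complexified operator `L ⊗ I_d`. -/
noncomputable def nodeOperator (d : ℕ) (L : Matrix (Fin n) (Fin n) ℝ) :
    Module.End ℂ (Fin n × Fin d → ℂ) :=
  toLin' (L.map Complex.ofReal ⊗ₖ (1 : Matrix (Fin d) (Fin d) ℂ))

/-- The complexified operator `I_n ⊗ C`. -/
noncomputable def topicOperator (n : ℕ) (C : Matrix (Fin d) (Fin d) ℝ) :
    Module.End ℂ (Fin n × Fin d → ℂ) :=
  toLin' ((1 : Matrix (Fin n) (Fin n) ℂ) ⊗ₖ C.map Complex.ofReal)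

/-- The complexified operator `I_{nd} + (L - I_n) ⊗ C`. -/
noncomputable def baseOperator (L : Matrix (Fin n) (Fin n) ℝ) (C : Matrix (Fin d) (Fin d) ℝ) :
    Module.End ℂ (Fin n × Fin d → ℂ) :=
  1 + (nodeOperator d L - 1) * topicOperator n C

lemma nodeOperator_apply (L : Matrix (Fin n) (Fin n) ℝ) (v : Fin n × Fin d → ℂ) (i : Fin n)
    (k : Fin d) :
    nodeOperator d L v (i, k) = (L.map Complex.ofReal *ᵥ fun j => v (j, k)) i := by
  simp [nodeOperator, mulVec, dotProduct, Fintype.sum_prod_type, one_apply]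

lemma topicOperator_apply (C : Matrix (Fin d) (Fin d) ℝ) (v : Fin n × Fin d → ℂ) (i : Fin n)
    (k : Fin d) :
    topicOperator n C v (i, k) = (C.map Complex.ofReal *ᵥ fun l => v (i, l)) k := by
  simp only [topicOperator, toLin'_apply, mulVec, dotProduct, Fintype.sum_prod_type,
    kroneckerMap_apply, one_apply, ite_mul, one_mul, zero_mul]
  rw [Finset.sum_comm]
  simp

lemma commute_nodeOperator_topicOperator (L : Matrix (Fin n) (Fin n) ℝ)
    (C : Matrix (Fin d) (Fin d) ℝ) : Commute (nodeOperator d L) (topicOperator n C) := by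
  rw [Commute, SemiconjBy, nodeOperator, topicOperator, Module.End.mul_eq_comp,
    Module.End.mul_eq_comp, ← toLin'_mul, ← toLin'_mul, ← mul_kronecker_mul, ← mul_kronecker_mul]
  simp

lemma baseOperator_apply (L : Matrix (Fin n) (Fin n) ℝ) (C : Matrix (Fin d) (Fin d) ℝ)
    (v : Fin n × Fin d → ℂ) : baseOperator L C v =
      v + (nodeOperator d L (topicOperator n C v) - topicOperator n C v) := by
  simp [baseOperator]

lemma systemMatrix_mulVec (G : WeightedDigraph n) (C : Matrix (Fin d) (Fin d) ℝ) (b : Fin n → ℝ)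
    (v : Fin n × Fin d → ℂ) : (systemMatrix G C b).map Complex.ofReal *ᵥ v =
      baseOperator G.laplacian C v + fun ik => (b ik.1 : ℂ) * v ik := by
  have h1 : (systemMatrix G C b).map Complex.ofReal =
      1 + (G.laplacian.map Complex.ofReal ⊗ₖ (1 : Matrix (Fin d) (Fin d) ℂ) - 1) *
        ((1 : Matrix (Fin n) (Fin n) ℂ) ⊗ₖ C.map Complex.ofReal) +
        diagonal fun ik => (b ik.1 : ℂ) := by
    rw [sub_mul, one_mul, ← mul_kronecker_mul, mul_one, one_mul]
    ext ⟨i, k⟩ ⟨j, l⟩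
    by_cases hij : i = j <;> by_cases hkl : k = l <;>
      simp [systemMatrix, stubbornnessMatrix, one_apply, hij, hkl, sub_mul]
  rw [h1, add_mulVec, add_mulVec, one_mulVec, ← mulVec_mulVec, sub_mulVec, one_mulVec,
    baseOperator_apply]
  congr 1
  funext ik
  rw [mulVec_diagonal]

lemma mem_eigenvalues_of_nodeOperator {L : Matrix (Fin n) (Fin n) ℝ} {v : Fin n × Fin d → ℂ}
    (hv : v ≠ 0) {μ : ℂ} (h : nodeOperator d L v = μ • v) : μ ∈ eigenvalues L := by
  obtain ⟨⟨i, k⟩, hik⟩ := Function.ne_iff.1 hv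
  refine mem_eigenvalues_of_mulVec (v := fun j => v (j, k)) (fun h0 => hik (congrFun h0 i)) ?_
  funext j
  rw [← nodeOperator_apply, h]
  rfl

lemma mem_eigenvalues_of_topicOperator {C : Matrix (Fin d) (Fin d) ℝ} {v : Fin n × Fin d → ℂ}
    (hv : v ≠ 0) {z : ℂ} (h : topicOperator n C v = z • v) : z ∈ eigenvalues C := by
  obtain ⟨⟨i, k⟩, hik⟩ := Function.ne_iff.1 hv
  refine mem_eigenvalues_of_mulVec (v := fun l => v (i, l)) (fun h0 => hik (congrFun h0 k)) ?_
  funext l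
  rw [← topicOperator_apply, h]
  rfl

lemma ConsensusCondition.eq_zero_and_eq_one {L : Matrix (Fin n) (Fin n) ℝ}
    {C : Matrix (Fin d) (Fin d) ℝ} (hcons : ConsensusCondition L C) (hC : IsLogicMatrix C)
    {μ z : ℂ} (hμ : μ ∈ eigenvalues L) (hz : z ∈ eigenvalues C) (h : 1 ≤ ((1 - μ) * z).re) :
    μ = 0 ∧ z = 1 := by
  have hμ0 : μ = 0 := by
    by_contra hne
    exact absurd h (not_le.2 (hcons μ ((Multiset.mem_erase_of_ne hne).2 hμ) z hz))
  refine ⟨hμ0, ?_⟩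
  by_contra hne
  have := hC.re_lt_one z hz hne
  simp [hμ0] at h
  linarith

lemma commute_baseOperator_nodeOperator (L : Matrix (Fin n) (Fin n) ℝ)
    (C : Matrix (Fin d) (Fin d) ℝ) : Commute (baseOperator L C) (nodeOperator d L) :=
  (Commute.one_left _).add_left
    (((Commute.refl _).sub_left (Commute.one_left _)).mul_left
      (commute_nodeOperator_topicOperator L C).symm)

lemma commute_baseOperator_topicOperator (L : Matrix (Fin n) (Fin n) ℝ)
    (C : Matrix (Fin d) (Fin d) ℝ) : Commute (baseOperator L C) (topicOperator n C) :=
  (Commute.one_left _).add_left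
    (((commute_nodeOperator_topicOperator L C).sub_left (Commute.one_left _)).mul_left
      (Commute.refl _))

/-- A common eigenvector in `W` gives `μ = 1 - (1 - ν) z`. A general invariant `W` is allowed so
that the eigenspace can also be cut down by an eigenspace of `topicOperator`. -/
lemma exists_eigenvector_of_baseOperator {L : Matrix (Fin n) (Fin n) ℝ}
    {C : Matrix (Fin d) (Fin d) ℝ} (hcons : ConsensusCondition L C) (hC : IsLogicMatrix C)
    {μ : ℂ} (hμ : μ.re ≤ 0) {W : Submodule ℂ (Fin n × Fin d → ℂ)} (hW : W ≠ ⊥)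
    (hP : ∀ v ∈ W, nodeOperator d L v ∈ W) (hQ : ∀ v ∈ W, topicOperator n C v ∈ W)
    (hWμ : W ≤ Module.End.eigenspace (baseOperator L C) μ) :
    μ = 0 ∧ ∃ v ∈ W, v ≠ 0 ∧ topicOperator n C v = v := by
  obtain ⟨v, hvW, hv, ν, z, hν, hz⟩ :=
    exists_common_eigenvector (commute_nodeOperator_topicOperator L C) hW hP hQ
  have h1 := Module.End.mem_eigenspace_iff.1 (hWμ hvW)
  have h2 : (1 - (1 - ν) * z) • v = μ • v := by
    rw [← h1, baseOperator_apply, hz, map_smul, hν]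
    module
  have h3 : 1 - (1 - ν) * z = μ := smul_left_injective ℂ hv h2
  obtain ⟨rfl, rfl⟩ := hcons.eq_zero_and_eq_one hC (mem_eigenvalues_of_nodeOperator hv hν)
    (mem_eigenvalues_of_topicOperator hv hz) (by
      have := congrArg Complex.re h3
      rw [Complex.sub_re, Complex.one_re] at this
      linarith)
  exact ⟨by rw [← h3]; ring, v, hvW, hv, by rw [hz, one_smul]⟩

lemma mem_eigenspace_of_commute {V : Type*} [AddCommGroup V] [Module ℂ V] {f g : Module.End ℂ V}
    (h : Commute f g) {μ : ℂ} {v : V} (hv : v ∈ Module.End.eigenspace f μ) :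
    g v ∈ Module.End.eigenspace f μ :=
  Module.End.mapsTo_genEigenspace_of_comm h μ 1 hv

lemma eq_zero_of_baseOperator_apply {L : Matrix (Fin n) (Fin n) ℝ}
    {C : Matrix (Fin d) (Fin d) ℝ} (hcons : ConsensusCondition L C) (hC : IsLogicMatrix C)
    {μ : ℂ} (hμ : μ.re ≤ 0) {v : Fin n × Fin d → ℂ} (hv : v ≠ 0)
    (h : baseOperator L C v = μ • v) : μ = 0 :=
  (exists_eigenvector_of_baseOperator hcons hC hμ
    ((Submodule.ne_bot_iff _).2 ⟨v, Module.End.mem_eigenspace_iff.2 h, hv⟩)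
    (fun _ => mem_eigenspace_of_commute (commute_baseOperator_nodeOperator L C))
    (fun _ => mem_eigenspace_of_commute (commute_baseOperator_topicOperator L C)) le_rfl).1

/-- On the kernel, `topicOperator` has no eigenvalue but `1`, so the kernel lies in its generalized
`1`-eigenspace; semi-simplicity of `C`, applied at each node, removes the nilpotent part. -/
lemma topicOperator_eq_of_baseOperator_eq_zero {L : Matrix (Fin n) (Fin n) ℝ}
    {C : Matrix (Fin d) (Fin d) ℝ} (hcons : ConsensusCondition L C) (hC : IsLogicMatrix C)
    {v : Fin n × Fin d → ℂ} (h : baseOperator L C v = 0) : topicOperator n C v = v := by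
  have hmem : v ∈ (topicOperator n C).maxGenEigenspace 1 := by
    refine mem_maxGenEigenspace_of_forall_eigenvalue_eq (W := Module.End.eigenspace (baseOperator L C) 0)
      (fun _ => mem_eigenspace_of_commute (commute_baseOperator_topicOperator L C))
      (fun w hw hw0 z hz => ?_) (Module.End.mem_eigenspace_iff.2 (by rw [h, zero_smul]))
    obtain ⟨-, u, hu, hu0, hu1⟩ := exists_eigenvector_of_baseOperator hcons hC (μ := 0) le_rfl
      (W := Module.End.eigenspace (baseOperator L C) 0 ⊓
        Module.End.eigenspace (topicOperator n C) z)
      ((Submodule.ne_bot_iff _).2 ⟨w, ⟨hw, Module.End.mem_eigenspace_iff.2 hz⟩, hw0⟩)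
      (fun x hx => ⟨mem_eigenspace_of_commute (commute_baseOperator_nodeOperator L C) hx.1,
        mem_eigenspace_of_commute (commute_nodeOperator_topicOperator L C).symm hx.2⟩)
      (fun x hx => ⟨mem_eigenspace_of_commute (commute_baseOperator_topicOperator L C) hx.1,
        mem_eigenspace_of_commute (Commute.refl _) hx.2⟩) inf_le_left
    have h2 := Module.End.mem_eigenspace_iff.1 hu.2
    rw [hu1] at h2
    exact smul_left_injective ℂ hu0 (by simpa using h2.symm)
  obtain ⟨k, hk⟩ := (Module.End.mem_maxGenEigenspace _ _ _).1 hmem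
  have hfib : ∀ (k : ℕ) (w : Fin n × Fin d → ℂ) (i : Fin n),
      (fun l => ((topicOperator n C - (1 : ℂ) • 1) ^ k) w (i, l)) =
        ((toLin' (C.map Complex.ofReal) - (1 : ℂ) • 1) ^ k) fun l => w (i, l) := by
    intro k
    induction k with
    | zero => intro w i; simp
    | succ k ih =>
      intro w i
      rw [pow_succ, Module.End.mul_apply, ih, pow_succ, Module.End.mul_apply]
      congr 1
      funext l
      simp [topicOperator_apply]
  funext ⟨i, k'⟩
  have h1 : ((toLin' (C.map Complex.ofReal) - (1 : ℂ) • 1) ^ k) (fun l => v (i, l)) = 0 := by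
    rw [← hfib, hk]
    rfl
  rw [topicOperator_apply, hC.mulVec_eq_of_pow h1]

lemma consensus_of_baseOperator_eq_zero {G : WeightedDigraph n} {C : Matrix (Fin d) (Fin d) ℝ}
    (hcons : ConsensusCondition G.laplacian C) (hC : IsLogicMatrix C)
    (hG : G.HasDirectedSpanningTree) {v : Fin n × Fin d → ℂ}
    (h : baseOperator G.laplacian C v = 0) (i j : Fin n) (k : Fin d) : v (i, k) = v (j, k) := by
  have h1 := topicOperator_eq_of_baseOperator_eq_zero hcons hC h
  rw [baseOperator_apply, h1, add_sub_cancel] at h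
  refine WeightedDigraph.eq_of_complex_laplacian_mulVec_eq_zero hG (x := fun i => v (i, k)) ?_ i j
  funext i
  rw [← nodeOperator_apply, h]
  rfl

/-- Under `f` the identity cancels `-topicOperator`, and `p` kills the remaining Laplacian term. -/
lemma sum_mul_dotProduct_baseOperator {L : Matrix (Fin n) (Fin n) ℝ}
    {C : Matrix (Fin d) (Fin d) ℝ} {p : Fin n → ℝ} (hp : p ᵥ* L = 0) {f : Fin d → ℂ}
    (hf : f ᵥ* C.map Complex.ofReal = f) (v : Fin n × Fin d → ℂ) :
    ∑ i, (p i : ℂ) * (f ⬝ᵥ fun k => baseOperator L C v (i, k)) = 0 := by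
  have hQ : ∀ i, (f ⬝ᵥ fun k => topicOperator n C v (i, k)) = f ⬝ᵥ fun k => v (i, k) := by
    intro i
    simp only [topicOperator_apply]
    rw [show (fun k => (C.map Complex.ofReal *ᵥ fun l => v (i, l)) k) =
      C.map Complex.ofReal *ᵥ fun l => v (i, l) from rfl, dotProduct_mulVec, hf]
  have hP : ∀ w : Fin n × Fin d → ℂ,
      ∑ i, (p i : ℂ) * (f ⬝ᵥ fun k => nodeOperator d L w (i, k)) = 0 := by
    intro w
    have hpc : (fun i => (p i : ℂ)) ᵥ* L.map Complex.ofReal = 0 := by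
      funext j
      have := congrFun hp j
      simp only [vecMul, dotProduct, Pi.zero_apply] at this
      simp only [vecMul, dotProduct, map_apply, Pi.zero_apply]
      exact_mod_cast this
    have hk : ∀ k, ∑ i, (p i : ℂ) * nodeOperator d L w (i, k) = 0 := by
      intro k
      simp only [nodeOperator_apply]
      have := dotProduct_mulVec (fun i => (p i : ℂ)) (L.map Complex.ofReal) (fun j => w (j, k))
      rw [hpc, zero_dotProduct] at this
      exact this
    simp only [dotProduct, Finset.mul_sum]
    rw [Finset.sum_comm]
    refine Finset.sum_eq_zero fun k _ => ?_
    rw [← mul_zero (f k), ← hk k, Finset.mul_sum]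
    exact Finset.sum_congr rfl fun i _ => by ring
  have hbase : ∀ i, (f ⬝ᵥ fun k => baseOperator L C v (i, k)) =
      f ⬝ᵥ fun k => nodeOperator d L (topicOperator n C v) (i, k) := by
    intro i
    have : (fun k => baseOperator L C v (i, k)) = (fun k => v (i, k)) +
        ((fun k => nodeOperator d L (topicOperator n C v) (i, k)) -
          fun k => topicOperator n C v (i, k)) := by
      rw [baseOperator_apply]; rfl
    rw [this, dotProduct_add, dotProduct_sub, hQ, add_sub_cancel]
  simp only [hbase]
  exact hP _

end Spectral

/-! ### Compactness and perturbation of the zero eigenvalue. -/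

section Perturbation

variable {n d : ℕ}

lemma exists_tendsto_eigenvector (T : Module.End ℂ (Fin n × Fin d → ℂ)) {b : ℕ → Fin n → ℝ}
    (hb : Tendsto b atTop (𝓝 0)) {μ : ℕ → ℂ} {v : ℕ → Fin n × Fin d → ℂ} (hv : ∀ m, ‖v m‖ = 1)
    (h : ∀ m, (T (v m) + fun ik => (b m ik.1 : ℂ) * v m ik) = μ m • v m) :
    ∃ (μ₀ : ℂ) (v₀ : Fin n × Fin d → ℂ) (φ : ℕ → ℕ), StrictMono φ ∧
      Tendsto (μ ∘ φ) atTop (𝓝 μ₀) ∧ Tendsto (v ∘ φ) atTop (𝓝 v₀) ∧ ‖v₀‖ = 1 ∧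
      T v₀ = μ₀ • v₀ := by
  set S := LinearMap.toContinuousLinearMap T with hS
  have hbv : Tendsto (fun m => (fun ik : Fin n × Fin d => (b m ik.1 : ℂ) * v m ik)) atTop
      (𝓝 0) := by
    rw [tendsto_pi_nhds]
    intro ik
    have h1 : Tendsto (fun m => b m ik.1) atTop (𝓝 0) := (tendsto_pi_nhds.1 hb ik.1)
    rw [Pi.zero_apply, tendsto_zero_iff_norm_tendsto_zero]
    rw [tendsto_zero_iff_norm_tendsto_zero] at h1
    refine squeeze_zero (fun _ => norm_nonneg _) (fun m => ?_) h1
    rw [norm_mul, Complex.norm_real]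
    exact mul_le_of_le_one_right (norm_nonneg _) ((norm_le_pi_norm _ _).trans (hv m).le)
  obtain ⟨K, hK⟩ := hbv.norm.bddAbove_range
  have hμ : ∀ m, ‖μ m‖ ≤ ‖S‖ + K := by
    intro m
    calc ‖μ m‖ = ‖μ m • v m‖ := by rw [norm_smul, hv, mul_one]
      _ ≤ ‖S (v m)‖ + ‖fun ik : Fin n × Fin d => (b m ik.1 : ℂ) * v m ik‖ := by
        rw [← h]; exact norm_add_le _ _
      _ ≤ ‖S‖ + K := by
        refine add_le_add ?_ (hK ⟨m, rfl⟩)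
        simpa [hv] using S.le_opNorm (v m)
  have hbdd : Bornology.IsBounded (Metric.closedBall (0 : ℂ) (‖S‖ + K) ×ˢ
      Metric.closedBall (0 : Fin n × Fin d → ℂ) 1) :=
    Metric.isBounded_closedBall.prod Metric.isBounded_closedBall
  obtain ⟨⟨μ₀, v₀⟩, -, φ, hφ, hlim⟩ := tendsto_subseq_of_bounded hbdd (x := fun m => (μ m, v m))
    fun m => ⟨by simpa using hμ m, by simp [hv]⟩
  have hμlim : Tendsto (μ ∘ φ) atTop (𝓝 μ₀) := (continuous_fst.tendsto _).comp hlim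
  have hvlim : Tendsto (v ∘ φ) atTop (𝓝 v₀) := (continuous_snd.tendsto _).comp hlim
  refine ⟨μ₀, v₀, φ, hφ, hμlim, hvlim, ?_, ?_⟩
  · refine tendsto_nhds_unique hvlim.norm ?_
    simp [hv]
  · have h1 := ((S.continuous.tendsto v₀).comp hvlim).add (hbv.comp hφ.tendsto_atTop)
    have h2 := hμlim.smul hvlim
    rw [add_zero] at h1
    refine tendsto_nhds_unique h1 (h2.congr fun m => ?_)
    exact (h (φ m)).symm

lemma exists_unit_eigenvector {ι : Type*} [Fintype ι] {F : Matrix ι ι ℝ}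
    (hF : ¬ IsPositiveStable F) :
    ∃ (μ : ℂ) (v : ι → ℂ), ‖v‖ = 1 ∧ μ.re ≤ 0 ∧ F.map Complex.ofReal *ᵥ v = μ • v := by
  simp only [IsPositiveStable, not_forall, not_lt] at hF
  obtain ⟨μ, v, hv, h, hμ⟩ := hF
  refine ⟨μ, ((‖v‖⁻¹ : ℝ) : ℂ) • v, ?_, hμ, ?_⟩
  · rw [norm_smul, Complex.norm_real, norm_inv, norm_norm, inv_mul_cancel₀ (norm_ne_zero_iff.2 hv)]
  · rw [mulVec_smul, h, smul_comm]

lemma tendsto_zero_of_forall_abs_lt {b : ℕ → Fin n → ℝ}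
    (hb : ∀ m i, |b m i| < 1 / ((m : ℝ) + 1)) : Tendsto b atTop (𝓝 0) := by
  rw [tendsto_pi_nhds]
  intro i
  exact squeeze_zero_norm (fun m => (hb m i).le) tendsto_one_div_add_atTop_nhds_zero_nat

variable {r : ℕ} {G : WeightedDigraph n} {C : Matrix (Fin d) (Fin d) ℝ}

lemma exists_isPositiveStable_of_small (hC : IsLogicMatrix C) (hG : G.HasDirectedSpanningTree)
    (hr : G.IsRootOrdered r) (hcons : ConsensusCondition G.laplacian C) :
    ∃ δ : ℝ, 0 < δ ∧ ∀ b : Fin n → ℝ, (∀ i, 0 ≤ b i ∧ b i < δ) →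
      (∃ j : Fin n, j.val < r ∧ 0 < b j) → IsPositiveStable (systemMatrix G C b) := by
  by_contra! hcon
  choose b hb hbr hstab using fun m : ℕ => hcon (1 / ((m : ℝ) + 1)) (by positivity)
  choose μ v hv hμ hμv using fun m => exists_unit_eigenvector (hstab m)
  simp only [systemMatrix_mulVec] at hμv
  obtain ⟨μ₀, v₀, φ, hφ, hμlim, hvlim, hv₀, hT⟩ := exists_tendsto_eigenvector _
    (tendsto_zero_of_forall_abs_lt fun m i => by
      rw [abs_of_nonneg (hb m i).1]; exact (hb m i).2) hv hμv
  have hv₀0 : v₀ ≠ 0 := by rintro rfl; simp at hv₀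
  have hμ₀ : μ₀ = 0 := eq_zero_of_baseOperator_apply hcons hC
    (le_of_tendsto ((Complex.continuous_re.tendsto _).comp hμlim)
      (Eventually.of_forall fun m => hμ (φ m))) hv₀0 hT
  rw [hμ₀, zero_smul] at hT
  obtain ⟨⟨i₀, k₀⟩, hik⟩ := Function.ne_iff.1 hv₀0
  have hconst := consensus_of_baseOperator_eq_zero hcons hC hG hT
  have hQ := topicOperator_eq_of_baseOperator_eq_zero hcons hC hT
  obtain ⟨f, hf, hfu⟩ := hC.exists_left_eigenvector (u := fun k => v₀ (i₀, k))
    (fun h0 => hik (congrFun h0 k₀)) (by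
      funext k
      rw [← topicOperator_apply, hQ])
  obtain ⟨p, hp, hpL, hpr⟩ := WeightedDigraph.IsRootOrdered.exists_left_null hG hr
  set z : ℕ → Fin n → ℂ := fun m i => f ⬝ᵥ fun k => v (φ m) (i, k) with hz
  set D : ℕ → ℂ := fun m => ∑ i, (p i : ℂ) * z m i with hD
  have hzlim : ∀ i, Tendsto (fun m => z m i) atTop (𝓝 1) := by
    intro i
    have h1 : (f ⬝ᵥ fun k => v₀ (i, k)) = 1 := by
      rw [← hfu]
      congr 1
      funext k
      exact hconst i i₀ k
    rw [← h1]
    exact tendsto_finsetSum _ fun k _ => (tendsto_pi_nhds.1 hvlim (i, k)).const_mul _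
  have hDlim : Tendsto D atTop (𝓝 (∑ i, (p i : ℂ))) := by
    simpa using tendsto_finsetSum Finset.univ fun i _ => (hzlim i).const_mul (p i : ℂ)
  have hpsum : 0 < ∑ i, p i := by
    obtain ⟨j, hj, -⟩ := hbr 0
    exact Finset.sum_pos' (fun i _ => hp i) ⟨j, Finset.mem_univ j, hpr j hj⟩
  -- The limit of each product is `∑ p_i`, a positive real.
  have hpos : ∀ᶠ m in atTop, ∀ i, 0 < (z m i * starRingEnd ℂ (D m)).re := by
    rw [eventually_all]
    intro i
    have h1 := (Complex.continuous_re.tendsto _).comp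
      ((hzlim i).mul ((Complex.continuous_conj.tendsto _).comp hDlim))
    refine h1.eventually (lt_mem_nhds ?_)
    simpa using hpsum
  obtain ⟨m, hm⟩ := hpos.exists
  have hident : μ (φ m) * D m = ∑ i, ((p i * b (φ m) i : ℝ) : ℂ) * z m i := by
    have h1 := sum_mul_dotProduct_baseOperator hpL hf (v (φ m))
    rw [eq_sub_of_add_eq (hμv (φ m))] at h1
    rw [← sub_eq_zero, ← h1, hD, Finset.mul_sum, ← Finset.sum_sub_distrib]
    refine Finset.sum_congr rfl fun i _ => ?_
    have h2 : (fun k => (μ (φ m) • v (φ m) - fun ik => (b (φ m) ik.1 : ℂ) * v (φ m) ik) (i, k)) =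
        μ (φ m) • (fun k => v (φ m) (i, k)) - (b (φ m) i : ℂ) • fun k => v (φ m) (i, k) := rfl
    rw [h2, dotProduct_sub, dotProduct_smul, dotProduct_smul]
    simp only [hz, smul_eq_mul]
    push_cast
    ring
  have hleft : (μ (φ m) * D m * starRingEnd ℂ (D m)).re ≤ 0 := by
    rw [mul_assoc, Complex.mul_conj, Complex.re_mul_ofReal]
    exact mul_nonpos_of_nonpos_of_nonneg (hμ _) (Complex.normSq_nonneg _)
  have hright : 0 < (μ (φ m) * D m * starRingEnd ℂ (D m)).re := by
    rw [hident, Finset.sum_mul, Complex.re_sum]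
    obtain ⟨j, hj, hbj⟩ := hbr (φ m)
    have hterm : ∀ i, (((p i * b (φ m) i : ℝ) : ℂ) * z m i * starRingEnd ℂ (D m)).re =
        p i * b (φ m) i * (z m i * starRingEnd ℂ (D m)).re := fun i => by
      rw [mul_assoc, Complex.re_ofReal_mul]
    simp only [hterm]
    exact Finset.sum_pos' (fun i _ => mul_nonneg (mul_nonneg (hp i) (hb _ i).1) (hm i).le)
      ⟨j, Finset.mem_univ j, mul_pos (mul_pos (hpr j hj) hbj) (hm j)⟩
  exact absurd hright (not_lt.2 hleft)

lemma exists_isPositiveStable_of_near_const (hC : IsLogicMatrix C)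
    (hcons : ConsensusCondition G.laplacian C) {α : ℝ} (hα : 0 < α) :
    ∃ δ : ℝ, 0 < δ ∧ ∀ ε : Fin n → ℝ, (∀ i, |ε i| < δ) →
      IsPositiveStable (systemMatrix G C fun i => α + ε i) := by
  by_contra! hcon
  choose ε hε hstab using fun m : ℕ => hcon (1 / ((m : ℝ) + 1)) (by positivity)
  choose μ v hv hμ hμv using fun m => exists_unit_eigenvector (hstab m)
  -- The shift by `α` joins the fixed operator, leaving a perturbation that tends to zero.
  have hμv' : ∀ m, ((baseOperator G.laplacian C + (α : ℂ) • 1) (v m) +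
      fun ik => (ε m ik.1 : ℂ) * v m ik) = μ m • v m := by
    intro m
    rw [← hμv m, systemMatrix_mulVec]
    funext ik
    simp only [LinearMap.add_apply, LinearMap.smul_apply, Module.End.one_apply, Pi.add_apply,
      Pi.smul_apply, smul_eq_mul, Complex.ofReal_add]
    ring
  obtain ⟨μ₀, v₀, φ, hφ, hμlim, hvlim, hv₀, hT⟩ := exists_tendsto_eigenvector _
    (tendsto_zero_of_forall_abs_lt hε) hv hμv'
  have hv₀0 : v₀ ≠ 0 := by rintro rfl; simp at hv₀
  have hre : μ₀.re ≤ 0 := le_of_tendsto ((Complex.continuous_re.tendsto _).comp hμlim)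
    (Eventually.of_forall fun m => hμ (φ m))
  have h1 : baseOperator G.laplacian C v₀ = (μ₀ - α) • v₀ := by
    rw [sub_smul, ← hT]
    simp
  have h2 : (μ₀ - α).re ≤ 0 := by
    rw [Complex.sub_re, Complex.ofReal_re]
    linarith
  -- The only eigenvalue of `baseOperator` available to `μ₀ - α` is `0`, so `μ₀ = α > 0`, against
  -- `hre`.
  have h3 := congrArg Complex.re (eq_zero_of_baseOperator_apply hcons hC h2 hv₀0 h1)
  rw [Complex.sub_re, Complex.ofReal_re, Complex.zero_re] at h3
  linarith

end Perturbation

end OpinionDynamics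

theorem mainTheorem8 {n d r : ℕ} (G : OpinionDynamics.WeightedDigraph n)
    (C : Matrix (Fin d) (Fin d) ℝ)
    (hC : OpinionDynamics.IsLogicMatrix C)
    (hG : G.HasDirectedSpanningTree) (hr : G.IsRootOrdered r)
    (hcons : OpinionDynamics.ConsensusCondition G.laplacian C) :
    (∃ δ : ℝ, 0 < δ ∧ ∀ b : Fin n → ℝ,
      (∀ i, 0 ≤ b i ∧ b i < δ) → (∃ j : Fin n, j.val < r ∧ 0 < b j) →
        OpinionDynamics.ConvergesToStubbornLimit G C b) ∧
    (∀ α : ℝ, 0 < α → ∃ δ : ℝ, 0 < δ ∧ ∀ ε : Fin n → ℝ,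
      (∀ i, |ε i| < δ) →
        OpinionDynamics.ConvergesToStubbornLimit G C (fun i => α + ε i)) := by
  constructor
  · obtain ⟨δ, hδ, h⟩ := OpinionDynamics.exists_isPositiveStable_of_small hC hG hr hcons
    exact ⟨δ, hδ, fun b hb hbr =>
      OpinionDynamics.convergesToStubbornLimit_of_isPositiveStable (h b hb hbr)⟩
  · intro α hα
    obtain ⟨δ, hδ, h⟩ := OpinionDynamics.exists_isPositiveStable_of_near_const hC hcons hα
    exact ⟨δ, hδ, fun ε hε =>
      OpinionDynamics.convergesToStubbornLimit_of_isPositiveStable (h ε hε)⟩
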